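/- Let $n\in\mathbb N$, let $(S,\mathcal S)$ and $(T_i,\mathcal T_i)$, $i=1,\dots,n$, be measurable spaces such that each $\mathcal T_i$ is universally complete (it contains every set that belongs to the $\mu$-completion of $\mathcal T_i$ for every probability measure $\mu$ on $T_i$), and let each $A_i$ be a compact metrizable space with its Borel $\sigma$-algebra. Put $T=\prod_i T_i$, $T_{-i}=\prod_{j\ne i}T_j$, $A=\prod_i A_i$, with product $\sigma$-algebras. Let $G$ be the game with measurable payoffs $u_i:A\times S\times T\to\mathbb R$ and belief maps $\eta_i$, which are probability kernels from $T_i$ to $S\times T_{-i}$. Assume that for each $i$ - there is a measurable $\overline u_i:T_i\to[0,\infty)$ (fixed from now on) with $|u_i(a,s,t)|\le\overline u_i(t_i)$ for all $a,s,t$; - $a_i\mapsto u_i(a_i,a_{-i},s,t)$ is upper semicontinuous on $A_i$ for all $a_{-i},s,t$. A behavioral strategy of player $i$ is a probability kernel $\gamma_i$ from $T_i$ to $A_i$; $\mathcal R_i$ is the set of these and $\mathcal R=\prod_i\mathcal R_i$. For $\gamma\in\mathcal R$ let $$V_i(\gamma;s,t)=\int_{A_1}\!\cdots\!\int_{A_n}u_i(a,s,t)\,\gamma_1(t_1,da_1)\cdots\gamma_n(t_n,da_n),\qquad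 U_i(\gamma;t_i)=\int V_i(\gamma;s,t)\,\eta_i(t_i,d(s,t_{-i})).$$ $\mathsf{BE}$ is the set of $\gamma^*\in\mathcal R$ with $U_i(\gamma_i^*,\gamma_{-i}^*;t_i)\ge U_i(\gamma_i,\gamma_{-i}^*;t_i)$ for all $i$, **all** $t_i\in T_i$ and all $\gamma_i\in\mathcal R_i$. Let $\mathcal M$ be the set of product probability measures $\nu=\nu_0\otimes\nu_1\otimes\cdots\otimes\nu_n$ on $S\times T$ such that, for every $i$, $\eta_i(t_i,\cdot)\ll\nu_0\otimes\nu_{-i}$ for all $t_i\in T_i$, where $\nu_{-i}=\bigotimes_{j\ne i}\nu_j$, and $\int\overline u_i\,d\nu_i<\infty$. For $\nu\in\mathcal M$ let $f_{\nu,i}:T_i\times S\times T_{-i}\to[0,\infty)$ be any version of the Radon–Nikodym derivative of $\nu_i\otimes\eta_i$ with respect to $\nu_i\otimes(\nu_0\otimes\nu_{-i})$, and put $$\widetilde u_i(a,s,t)=u_i(a,s,t)\,f_{\nu,i}(t_i,s,t_{-i}),$$ $$\widetilde U_i(\gamma;\nu)=\int\Big(\int_{A_1}\!\cdots\!\int_{A_n}\widetilde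 u_i(a,s,t)\,\gamma_1(t_1,da_1)\cdots\gamma_n(t_n,da_n)\Big)\,\nu(d(s,t)).$$ $\mathsf{BNE}_\nu$ is the set of Bayesian Nash equilibria of the common-prior game with prior $\nu$ and payoffs $\widetilde u_i$: the $\gamma^*\in\mathcal R$ with $\widetilde U_i(\gamma_i^*,\gamma_{-i}^*;\nu)\ge\widetilde U_i(\gamma_i,\gamma_{-i}^*;\nu)$ for all $i$ and all $\gamma_i\in\mathcal R_i$. Write $\gamma\sim_\nu\gamma'$ if, for each $i$, $\gamma_i(t_i,\cdot)=\gamma_i'(t_i,\cdot)$ for $\nu_i$-almost every $t_i$. **Proposition.** For each $\nu\in\mathcal M$, $$\mathsf{BNE}_\nu=\{\gamma\in\mathcal R:\ \gamma\sim_\nu\gamma'\text{ for some }\gamma'\in\mathsf{BE}\}.$$ -/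

import Mathlib

open MeasureTheory ProbabilityTheory
open scoped NNReal ENNReal

/-- The σ-algebra of `X` is universally complete: it contains every set that belongs to the
`μ`-completion of the σ-algebra for every probability measure `μ`. -/
def IsUniversallyComplete (X : Type*) [MeasurableSpace X] : Prop :=
  ∀ E : Set X, (∀ μ : Measure X, IsProbabilityMeasure μ → NullMeasurableSet E μ) →
    MeasurableSet E

/-- The set `T_{-i}` of type profiles of the players other than `i`, with the product σ-algebra. -/
abbrev OtherTypes {n : ℕ} (T : Fin n → Type*) (i : Fin n) : Type _ :=
  ∀ j : {j : Fin n // j ≠ i}, T j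

/-- The profile `t = (t_i, t_{-i})`. -/
def joinTypes {n : ℕ} {T : Fin n → Type*} (i : Fin n) (ti : T i) (tmi : OtherTypes T i) :
    ∀ j, T j :=
  (Equiv.piSplitAt i T).symm (ti, tmi)

/-- An incomplete information game with `n` players, payoff types `S`, type sets `T i` and action
sets `A i`: measurable payoff functions `u i` and belief maps `η i` (probability kernels from `T i`
to `S × T_{-i}`). For second countable action spaces with their Borel σ-algebras, the product
σ-algebra on `∀ j, A j` used here is the Borel σ-algebra of the product. -/
structure IncompleteInfoGame {n : ℕ} (S : Type*) (T A : Fin n → Type*) [MeasurableSpace S]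
    [∀ i, MeasurableSpace (T i)] [∀ i, MeasurableSpace (A i)] where
  /-- payoff functions -/
  u : Fin n → (∀ j, A j) → S → (∀ j, T j) → ℝ
  measurable_u : ∀ i, Measurable fun p : (∀ j, A j) × S × (∀ j, T j) => u i p.1 p.2.1 p.2.2
  /-- belief maps -/
  η : ∀ i, Kernel (T i) (S × OtherTypes T i)
  markov_η : ∀ i, IsMarkovKernel (η i)

/-- Behavioral strategies: probability kernels from `Ti` to `Ai`. -/
abbrev BehavioralStrategy (Ti Ai : Type*) [MeasurableSpace Ti] [MeasurableSpace Ai] : Type _ :=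
  {γ : Kernel Ti Ai // IsMarkovKernel γ}

/-- Profiles of behavioral strategies. -/
abbrev StrategyProfile {n : ℕ} (T A : Fin n → Type*) [∀ i, MeasurableSpace (T i)]
    [∀ i, MeasurableSpace (A i)] : Type _ :=
  ∀ i, BehavioralStrategy (T i) (A i)

/-- Product probability measures `ν = ν_0 ⊗ ν_1 ⊗ ⋯ ⊗ ν_n` on `S × T`, given by their factors
(which are the marginals of `ν` and hence determined by it). -/
structure ProductProb {n : ℕ} (S : Type*) (T : Fin n → Type*) [MeasurableSpace S]
    [∀ i, MeasurableSpace (T i)] where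
  /-- the factor on `S` -/
  nature : Measure S
  /-- the factor on `T i` -/
  type : ∀ i, Measure (T i)
  prob_nature : IsProbabilityMeasure nature
  prob_type : ∀ i, IsProbabilityMeasure (type i)

namespace ProductProb

variable {n : ℕ} {S : Type*} {T : Fin n → Type*} [MeasurableSpace S] [∀ i, MeasurableSpace (T i)]

/-- The measure `ν` on `S × T`. -/
noncomputable def measure (ν : ProductProb S T) : Measure (S × (∀ j, T j)) :=
  haveI := ν.prob_nature
  haveI := ν.prob_type
  ν.nature.prod (Measure.pi ν.type)

/-- The measure `ν_0 ⊗ ν_{-i}` on `S × T_{-i}`. -/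
noncomputable def others (ν : ProductProb S T) (i : Fin n) : Measure (S × OtherTypes T i) :=
  haveI := ν.prob_nature
  haveI := ν.prob_type
  ν.nature.prod (Measure.pi fun j : {j : Fin n // j ≠ i} => ν.type j)

end ProductProb

/-- `γ ∼_ν γ'`: for each `i`, `γ_i(t_i, ·) = γ'_i(t_i, ·)` for `ν_i`-almost all `t_i`. -/
def StrategyEquiv {n : ℕ} {S : Type*} {T A : Fin n → Type*} [MeasurableSpace S]
    [∀ i, MeasurableSpace (T i)] [∀ i, MeasurableSpace (A i)] (ν : ProductProb S T)
    (γ γ' : StrategyProfile T A) : Prop :=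
  ∀ i, ∀ᵐ ti ∂(ν.type i), (γ i).1 ti = (γ' i).1 ti

/-- The payoff `∫_{A_1} ⋯ ∫_{A_n} v(a, s, t) γ_1(t_1, da_1) ⋯ γ_n(t_n, da_n)`. -/
noncomputable def mixedPayoff {n : ℕ} {S : Type*} {T A : Fin n → Type*}
    [∀ i, MeasurableSpace (T i)] [∀ i, MeasurableSpace (A i)]
    (v : (∀ j, A j) → S → (∀ j, T j) → ℝ) (γ : StrategyProfile T A) (s : S) (t : ∀ j, T j) : ℝ :=
  haveI := fun j => (γ j).2
  ∫ a, v a s t ∂(Measure.pi fun j => (γ j).1 (t j))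

namespace IncompleteInfoGame

variable {n : ℕ} {S : Type*} {T A : Fin n → Type*} [MeasurableSpace S]
  [∀ i, MeasurableSpace (T i)] [∀ i, MeasurableSpace (A i)]

/-- `|u_i(a, s, t)| ≤ ubar_i(t_i)` for measurable maps `ubar_i : T_i → [0, ∞)`. -/
def PayoffBound (G : IncompleteInfoGame S T A) (ubar : ∀ i, T i → ℝ≥0) : Prop :=
  ∀ i, Measurable (ubar i) ∧ ∀ a s t, |G.u i a s t| ≤ ubar i (t i)

/-- Each payoff function is upper semicontinuous in the player's own action. -/
def UpperSemicontinuousPayoffs [∀ i, TopologicalSpace (A i)] (G : IncompleteInfoGame S T A) :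
    Prop :=
  ∀ i a s t, UpperSemicontinuous fun ai : A i => G.u i (Function.update a i ai) s t

/-- The expected payoff `U_i(γ; t_i) = ∫ V_i(γ; s, t) η_i(t_i, d(s, t_{-i}))`. -/
noncomputable def expectedPayoff (G : IncompleteInfoGame S T A) (i : Fin n)
    (γ : StrategyProfile T A) (ti : T i) : ℝ :=
  ∫ p, mixedPayoff (G.u i) γ p.1 (joinTypes i ti p.2) ∂(G.η i ti)

/-- The set `BE` of Bayesian equilibria: optimality against every deviation at every type. -/
def BE (G : IncompleteInfoGame S T A) : Set (StrategyProfile T A) :=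
  {γ | ∀ i, ∀ ti : T i, ∀ δ : BehavioralStrategy (T i) (A i),
    G.expectedPayoff i (Function.update γ i δ) ti ≤ G.expectedPayoff i γ ti}

/-- The set `M` of product probability measures that dominate the belief maps,
`η_i(t_i, ·) ≪ ν_0 ⊗ ν_{-i}` for all `i` and `t_i`, and integrate the bounds `ubar i`. -/
def M (G : IncompleteInfoGame S T A) (ubar : ∀ i, T i → ℝ≥0) : Set (ProductProb S T) :=
  {ν | (∀ i, ∀ ti : T i, G.η i ti ≪ ν.others i) ∧
    ∀ i, ∫⁻ ti, (ubar i ti : ℝ≥0∞) ∂(ν.type i) < ∞}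

/-- `f i` is a version of the Radon-Nikodym derivative of `ν_i ⊗ η_i` with respect to
`ν_i ⊗ (ν_0 ⊗ ν_{-i})`, for each `i`. -/
def IsBeliefDensity (G : IncompleteInfoGame S T A) (ν : ProductProb S T)
    (f : ∀ i, T i × S × OtherTypes T i → ℝ≥0) : Prop :=
  ∀ i, Measurable (f i) ∧
    (ν.type i).compProd (G.η i) =
      ((ν.type i).prod (ν.others i)).withDensity fun x => (f i x : ℝ≥0∞)

/-- The density-weighted payoff `ũ_i(a, s, t) = u_i(a, s, t) f_i(t_i, s, t_{-i})`. -/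
def weightedPayoff (G : IncompleteInfoGame S T A) (f : ∀ i, T i × S × OtherTypes T i → ℝ≥0)
    (i : Fin n) (a : ∀ j, A j) (s : S) (t : ∀ j, T j) : ℝ :=
  G.u i a s t * f i (t i, s, fun j => t j)

/-- The ex ante expected payoff of player `i` in the game with common prior `ν` and
density-weighted payoffs. -/
noncomputable def exAntePayoff (G : IncompleteInfoGame S T A) (ν : ProductProb S T)
    (f : ∀ i, T i × S × OtherTypes T i → ℝ≥0) (i : Fin n) (γ : StrategyProfile T A) : ℝ :=
  ∫ p, mixedPayoff (G.weightedPayoff f i) γ p.1 p.2 ∂ν.measure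

/-- The set `BNE_ν` of Bayesian Nash equilibria of the game with common prior `ν` and
density-weighted payoffs. -/
def BNE (G : IncompleteInfoGame S T A) (ν : ProductProb S T)
    (f : ∀ i, T i × S × OtherTypes T i → ℝ≥0) : Set (StrategyProfile T A) :=
  {γ | ∀ i, ∀ δ : BehavioralStrategy (T i) (A i),
    G.exAntePayoff ν f i (Function.update γ i δ) ≤ G.exAntePayoff ν f i γ}

/-- The profiles that are `ν`-equivalent to some Bayesian equilibrium. -/
def BEClosure (G : IncompleteInfoGame S T A) (ν : ProductProb S T) : Set (StrategyProfile T A) :=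
  {γ | ∃ γ' ∈ G.BE, StrategyEquiv ν γ γ'}

end IncompleteInfoGame

/-! Since `f i` is a density of `ν_i ⊗ η_i`, Fubini turns the ex ante payoff into the `ν_i`-mean of
the interim payoffs (`PayoffBound.exAntePayoff_eq`). Since `η_i(t_i, ·) ≪ ν_0 ⊗ ν_{-i}` at every
type, changing the opponents' strategies on null sets changes no interim payoff at any `t_i`
(`expectedPayoff_congr`). Integrating interim optimality therefore shows that every profile
equivalent to a Bayesian equilibrium is a Bayesian Nash equilibrium.

Conversely, if player `i` has one strategy that is a best reply at all types simultaneously, an ex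
ante optimal `γ_i` must attain the same interim payoff almost everywhere. Replacing `γ_i` by that
best reply on the exceptional null set gives a Bayesian equilibrium.

Such a best reply is a measurable selection from the maximizers of the interim payoff over pure
actions. That payoff is upper semicontinuous by Fatou's lemma, and
`IsUniversallyComplete.exists_measurable_argmax` gives the selection. Universal completeness enters
through the measurable projection theorem, which rests on analytic sets being null-measurable. -/

/-! ### Analytic sets and the measurable projection theorem. -/

open Set Filter Topology in
/-- If the continuous image of the Baire space has measure greater than `r`, then so has, up to
equality, the image of a compact set. -/
theorem exists_isCompact_le_measure_image {Y : Type*} [TopologicalSpace Y] [MeasurableSpace Y]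
    (μ : Measure Y) [μ.OuterRegular] {g : (ℕ → ℕ) → Y} (hg : Continuous g) {r : ℝ≥0∞}
    (hr : r < μ (range g)) : ∃ K : Set (ℕ → ℕ), IsCompact K ∧ r ≤ μ (g '' K) := by
  -- Bounding coordinate `k` by `m` exhausts the set as `m` grows. Continuity from below holds for
  -- increasing unions of arbitrary sets, so the images need not be measurable.
  have step : ∀ (k : ℕ) (S : {S : Set (ℕ → ℕ) // r < μ (g '' S)}),
      ∃ m : ℕ, r < μ (g '' (S.1 ∩ {x | x k ≤ m})) := by
    rintro k ⟨S, hS⟩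
    have hU : g '' S = ⋃ m : ℕ, g '' (S ∩ {x | x k ≤ m}) := by
      rw [← image_iUnion, ← inter_iUnion]
      congr 1
      refine (inter_eq_left.2 fun x _ => mem_iUnion.2 ⟨x k, by simp⟩).symm
    have hmono : Monotone fun m : ℕ => g '' (S ∩ {x | x k ≤ m}) := fun a b hab =>
      image_mono (inter_subset_inter_right _ fun x (hx : x k ≤ a) => hx.trans hab)
    rw [hU, hmono.directed_le.measure_iUnion] at hS
    exact lt_iSup_iff.1 hS
  choose m hm using step
  let S : ℕ → {S : Set (ℕ → ℕ) // r < μ (g '' S)} := fun k =>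
    Nat.rec ⟨univ, by rwa [image_univ]⟩ (fun k S => ⟨S.1 ∩ {x | x k ≤ m k S}, hm k S⟩) k
  let c : ℕ → ℕ := fun k => m k (S k)
  have hS : ∀ k, (S k).1 = {x | ∀ i < k, x i ≤ c i} := by
    intro k
    induction k with
    | zero => simp [S]
    | succ k ih =>
      change (S k).1 ∩ {x | x k ≤ c k} = _
      rw [ih]
      ext x
      simp only [mem_inter_iff, mem_ofPred_eq, Nat.lt_succ_iff_lt_or_eq]
      constructor
      · rintro ⟨h, h'⟩ i (hi | rfl)
        exacts [h i hi, h']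
      · exact fun h => ⟨fun i hi => h i (.inl hi), h k (.inr rfl)⟩
  let K : Set (ℕ → ℕ) := univ.pi fun i => Iic (c i)
  have hK : IsCompact K := isCompact_univ_pi fun i => (finite_Iic (c i)).isCompact
  refine ⟨K, hK, ?_⟩
  -- Continuity from above is unavailable for the images of the `S k`. Outer regularity replaces it:
  -- an open set around `g '' K` already contains the image of some `S k`.
  rw [(g '' K).measure_eq_iInf_isOpen μ]
  refine le_iInf₂ fun U hKU => le_iInf fun hU => ?_
  obtain ⟨k, hk⟩ : ∃ k, (S k).1 ⊆ g ⁻¹' U := by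
    by_contra! hcon
    choose x hxS hxU using fun k => not_subset.1 (hcon k)
    have hy : ∀ k, (fun i => min (x k i) (c i)) ∈ K := fun k i _ => mem_Iic.2 (min_le_right _ _)
    obtain ⟨y, hyK, φ, hφ, hlim⟩ := hK.tendsto_subseq hy
    -- Points of `S k` agree with their truncations on the first `k` coordinates, so both sequences
    -- have the same limit in `K`.
    have hx : Tendsto (x ∘ φ) atTop (𝓝 y) := by
      rw [tendsto_pi_nhds] at hlim ⊢
      intro i
      refine (hlim i).congr' ?_
      filter_upwards [eventually_gt_atTop i] with k hk
      have := hxS (φ k)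
      rw [hS] at this
      exact min_eq_left (this i (hk.trans_le (hφ.id_le k)))
    have hyU : g ⁻¹' U ∈ 𝓝 y := (hU.preimage hg).mem_nhds (hKU (mem_image_of_mem g hyK))
    obtain ⟨k, hk⟩ := (hx.eventually hyU).exists
    exact hxU (φ k) hk
  exact (S k).2.le.trans (measure_mono (image_subset_iff.2 hk))

open Set Filter Topology in
/-- Analytic sets are null-measurable for every finite Borel measure. -/
theorem MeasureTheory.AnalyticSet.nullMeasurableSet {Y : Type*} [TopologicalSpace Y] [T2Space Y]
    [MeasurableSpace Y] [OpensMeasurableSpace Y] (μ : Measure Y) [IsFiniteMeasure μ]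
    [μ.OuterRegular] {s : Set Y} (hs : AnalyticSet s) : NullMeasurableSet s μ := by
  rw [AnalyticSet] at hs
  obtain rfl | ⟨g, hg, rfl⟩ := hs
  · exact nullMeasurableSet_empty
  obtain h0 | h0 := eq_or_ne (μ (range g)) 0
  · exact NullMeasurableSet.of_null h0
  -- Compact images of measure at least `r k ↑ μ (range g)` have a Borel union inside `range g` of
  -- the same, finite, measure.
  obtain ⟨r, -, hr, hlim⟩ := exists_seq_strictMono_tendsto' (pos_iff_ne_zero.2 h0)
  choose K hK hrK using fun k => exists_isCompact_le_measure_image μ hg (hr k).2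
  have hmeas : MeasurableSet (⋃ k, g '' K k) :=
    MeasurableSet.iUnion fun k => ((hK k).image hg).measurableSet
  have hle : μ (range g) ≤ μ (⋃ k, g '' K k) :=
    le_of_tendsto' hlim fun k => (hrK k).trans (measure_mono (subset_iUnion (fun k => g '' K k) k))
  have hsub : ⋃ k, g '' K k ⊆ range g := iUnion_subset fun k => image_subset_range _ _
  exact hmeas.nullMeasurableSet.congr
    (ae_eq_of_subset_of_measure_ge hsub hle hmeas.nullMeasurableSet (measure_ne_top μ _))

open Set in
/-- A measurable subset of a product is the preimage of a measurable set under a measurable map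
that replaces the second factor by the Cantor space. -/
theorem MeasurableSet.exists_eq_preimage_prodMap {X T : Type*} [MeasurableSpace X]
    [MeasurableSpace T] {E : Set (X × T)} (hE : MeasurableSet E) :
    ∃ (g : T → ℕ → Bool) (E' : Set (X × (ℕ → Bool))), Measurable g ∧ MeasurableSet E' ∧
      E = Prod.map id g ⁻¹' E' := by
  classical
  rw [← generateFrom_prod] at hE
  -- Sets of this form include the rectangles and are closed under complements and countable unions.
  induction E, hE using MeasurableSpace.generateFrom_induction with
  | hC s hs _ =>
    obtain ⟨a, ha, b, hb, rfl⟩ := hs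
    refine ⟨fun t _ => decide (t ∈ b), a ×ˢ {x | x 0 = true}, ?_, ?_, ?_⟩
    · refine measurable_pi_iff.2 fun _ => measurable_to_bool ?_
      simpa [preimage] using hb
    · exact MeasurableSet.prod ha (measurableSet_eq_fun (measurable_pi_apply 0) measurable_const)
    · ext; simp
  | empty => exact ⟨fun _ _ => true, ∅, measurable_const, .empty, by simp⟩
  | compl s _ ih =>
    obtain ⟨g, E', hg, hE', rfl⟩ := ih
    exact ⟨g, E'ᶜ, hg, hE'.compl, rfl⟩
  | iUnion s _ ih =>
    choose g E' hg hE' hs using ih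
    -- Countably many Cantor-valued maps are packed into one by a pairing of the indices.
    refine ⟨fun t k => g k.unpair.1 t k.unpair.2,
      ⋃ k, (fun p : X × (ℕ → Bool) => (p.1, fun m => p.2 (Nat.pair k m))) ⁻¹' E' k, ?_, ?_, ?_⟩
    · exact measurable_pi_iff.2 fun k => measurable_pi_iff.1 (hg _) _
    · refine MeasurableSet.iUnion fun k => measurableSet_preimage ?_ (hE' k)
      fun_prop
    · ext p
      simp only [mem_iUnion, mem_preimage, hs]
      simp [Prod.map]

open Set in
/-- The measurable projection theorem: the projection of a measurable set along a standard Borel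
space is measurable if the remaining factor is universally complete. -/
theorem IsUniversallyComplete.measurableSet_image_snd {X T : Type*} [MeasurableSpace X]
    [StandardBorelSpace X] [MeasurableSpace T] (hT : IsUniversallyComplete T) {E : Set (X × T)}
    (hE : MeasurableSet E) : MeasurableSet (Prod.snd '' E) := by
  refine hT _ fun μ hμ => ?_
  -- The arbitrary space `T` is replaced by the Cantor space, where the projection is analytic.
  -- Null-measurability for `μ.map g` pulls back along `g` to `μ`.
  obtain ⟨g, E', hg, hE', rfl⟩ := hE.exists_eq_preimage_prodMap
  have himage : Prod.snd '' (Prod.map id g ⁻¹' E' : Set (X × T)) = g ⁻¹' (Prod.snd '' E') := by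
    ext t
    simp
  have := Measure.isProbabilityMeasure_map (μ := μ) hg.aemeasurable
  rw [himage]
  exact ((hE'.analyticSet_image measurable_snd).nullMeasurableSet (μ.map g)).preimage
    (hg.quasiMeasurePreserving μ)

open Set in
theorem IsUniversallyComplete.measurableSet_setOf_exists {X T : Type*} [MeasurableSpace X]
    [StandardBorelSpace X] [MeasurableSpace T] (hT : IsUniversallyComplete T)
    {p : T → X → Prop} (hp : MeasurableSet {x : X × T | p x.2 x.1}) :
    MeasurableSet {t | ∃ x, p t x} := by
  convert hT.measurableSet_image_snd hp using 1
  ext t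
  simp

/-! ### The measurable maximum theorem. -/

open Set in
/-- Measurable selection of the least maximizer over a compact set of reals. -/
theorem IsUniversallyComplete.exists_measurable_argmax_subtype {T : Type*} [MeasurableSpace T]
    (hT : IsUniversallyComplete T) {C : Set ℝ} (hC : IsCompact C) (hne : C.Nonempty)
    {F : T → C → ℝ} (hF : Measurable fun p : C × T => F p.2 p.1)
    (husc : ∀ t, UpperSemicontinuous (F t)) :
    ∃ s : T → C, Measurable s ∧ ∀ t x, F t x ≤ F t (s t) := by
  have : CompactSpace C := isCompact_iff_compactSpace.1 hC
  have : Nonempty C := hne.to_subtype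
  have : StandardBorelSpace C := hC.isClosed.measurableSet.standardBorel
  have hmax : ∀ t, ∃ x, ∀ y, F t y ≤ F t x := fun t => by
    obtain ⟨x, -, hx⟩ := UpperSemicontinuousOn.exists_isMaxOn univ_nonempty isCompact_univ
      ((husc t).upperSemicontinuousOn univ)
    exact ⟨x, fun y => hx (mem_univ y)⟩
  choose x₀ hx₀ using hmax
  -- The maximum exceeds `c` iff some value does, so this superlevel set is a projection.
  have hval : Measurable fun t => F t (x₀ t) := by
    refine measurable_of_Ioi fun c => ?_
    convert hT.measurableSet_setOf_exists (p := fun t x => c < F t x)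
      (measurableSet_lt measurable_const hF) using 1
    ext t
    exact ⟨fun h => ⟨_, h⟩, fun ⟨x, hx⟩ => lt_of_lt_of_le hx (hx₀ t x)⟩
  -- The maximizers form a closed superlevel set. Choosing the least one makes `{s < c}` a
  -- projection too: it says that some maximizer lies below `c`.
  have hmin : ∀ t, ∃ x, F t x = F t (x₀ t) ∧ ∀ y, F t y = F t (x₀ t) → x ≤ y := fun t => by
    have hcl : IsClosed {x | F t (x₀ t) ≤ F t x} := (husc t).isClosed_preimage _
    obtain ⟨x, hx, hxmin⟩ := hcl.isCompact.exists_isLeast ⟨x₀ t, by simp⟩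
    exact ⟨x, le_antisymm (hx₀ t x) hx, fun y hy => hxmin hy.ge⟩
  choose s hs hsmin using hmin
  refine ⟨s, ?_, fun t x => (hs t).symm ▸ hx₀ t x⟩
  have hreal : Measurable fun t => (s t : ℝ) := by
    refine measurable_of_Iio fun c => ?_
    convert hT.measurableSet_setOf_exists (p := fun t (x : C) => F t x = F t (x₀ t) ∧ (x : ℝ) < c)
      ((measurableSet_eq_fun hF (hval.comp measurable_snd)).inter
        (measurableSet_lt (measurable_subtype_coe.comp measurable_fst) measurable_const)) using 1
    ext t
    exact ⟨fun h => ⟨s t, hs t, h⟩, fun ⟨x, hx, hxc⟩ =>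
      lt_of_le_of_lt (Subtype.coe_le_coe.2 (hsmin t x hx)) hxc⟩
  exact hreal.subtype_mk (h := fun t => (s t).2)

/-- The measurable maximum theorem: upper semicontinuous functions on a compact metrizable space
that depend measurably on a universally complete parameter have a measurable maximizer. -/
theorem IsUniversallyComplete.exists_measurable_argmax {T A : Type*} [MeasurableSpace T]
    (hT : IsUniversallyComplete T) [TopologicalSpace A] [CompactSpace A]
    [TopologicalSpace.MetrizableSpace A] [Nonempty A] [MeasurableSpace A] [BorelSpace A]
    {F : T → A → ℝ} (hF : Measurable fun p : A × T => F p.2 p.1)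
    (husc : ∀ t, UpperSemicontinuous (F t)) :
    ∃ s : T → A, Measurable s ∧ ∀ t a, F t a ≤ F t (s t) := by
  let := TopologicalSpace.metrizableSpaceMetric A
  -- A continuous surjection from the Cantor set in `ℝ` onto `A` supplies the order needed to select
  -- a least maximizer.
  obtain ⟨φ₀, hφ₀, hsurj₀⟩ := exists_nat_bool_continuous_surjective_of_compact A
  let φ : cantorSet → A := φ₀ ∘ cantorSetHomeomorphNatToBool
  have hφ : Continuous φ := hφ₀.comp cantorSetHomeomorphNatToBool.continuous
  have hsurj : Function.Surjective φ := hsurj₀.comp cantorSetHomeomorphNatToBool.surjective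
  obtain ⟨s, hs, hmax⟩ := hT.exists_measurable_argmax_subtype (F := fun t x => F t (φ x))
    isCompact_cantorSet ⟨0, zero_mem_cantorSet⟩
    (hF.comp ((hφ.measurable.comp measurable_fst).prodMk measurable_snd))
    (fun t => (husc t).comp hφ)
  refine ⟨φ ∘ s, hφ.measurable.comp hs, fun t a => ?_⟩
  obtain ⟨x, rfl⟩ := hsurj a
  exact hmax t x

/-! ### Upper semicontinuity of integrals. -/

open Filter Topology in
/-- The integral of uniformly bounded upper semicontinuous functions is upper semicontinuous. -/
theorem upperSemicontinuous_integral_of_bounded {A Y : Type*} [TopologicalSpace A]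
    [FirstCountableTopology A] [MeasurableSpace Y] (μ : Measure Y) [IsProbabilityMeasure μ]
    {h : A → Y → ℝ} {C : ℝ} (hm : ∀ a, Measurable (h a)) (hC : ∀ a y, |h a y| ≤ C)
    (husc : ∀ y, UpperSemicontinuous fun a => h a y) :
    UpperSemicontinuous fun a => ∫ y, h a y ∂μ := by
  have hint : ∀ a, Integrable (h a) μ := fun a =>
    Integrable.of_bound (hm a).aestronglyMeasurable C (ae_of_all _ (hC a))
  -- Fatou's lemma is applied to the reflected function. The extra `1` keeps its integral strictly
  -- positive, as strict comparison under `ENNReal.ofReal` requires.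
  let k : A → Y → ℝ≥0∞ := fun a y => ENNReal.ofReal (C + 1 - h a y)
  have hk : ∀ a, ∫⁻ y, k a y ∂μ = ENNReal.ofReal (C + 1 - ∫ y, h a y ∂μ) := fun a => by
    rw [← ofReal_integral_eq_lintegral_ofReal (f := fun y => C + 1 - h a y)
      ((integrable_const _).sub (hint a)) (ae_of_all _ fun y => ?_),
      integral_sub (integrable_const _) (hint a)]
    · simp
    · have := (abs_le.1 (hC a y)).2
      simp only [Pi.zero_apply]
      linarith
  have hle : ∀ a, ∫ y, h a y ∂μ ≤ C := fun a => by
    simpa using integral_mono (hint a) (integrable_const C) fun y => (abs_le.1 (hC a y)).2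
  have hlsc : ∀ y, LowerSemicontinuous fun a => k a y := fun y =>
    Continuous.comp_upperSemicontinuous_antitone (g := fun r : ℝ => ENNReal.ofReal (C + 1 - r))
      (ENNReal.continuous_ofReal.comp (by fun_prop)) (husc y) fun a b hab => ENNReal.ofReal_le_ofReal (by linarith)
  intro x c hc
  have hlt : ENNReal.ofReal (C + 1 - c) < liminf (fun a => ∫⁻ y, k a y ∂μ) (𝓝 x) := by
    refine lt_of_lt_of_le ?_ (lintegral_liminf_le fun a => by fun_prop)
    refine lt_of_lt_of_le ?_ (lintegral_mono fun y => LowerSemicontinuousAt.le_liminf (hlsc y x))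
    rw [hk, ENNReal.ofReal_lt_ofReal_iff]
    · linarith
    · linarith [hle x]
  filter_upwards [eventually_lt_of_lt_liminf hlt] with a ha
  rw [hk] at ha
  linarith [(ENNReal.ofReal_lt_ofReal_iff'.1 ha).1]

/-! ### Splitting one coordinate off a product measure. -/

/-- Product probability measures that agree off `i`: the `i`-th coordinate may be sampled
separately. -/
theorem pi_eq_map_update {n : ℕ} {A : Fin n → Type*} [∀ j, MeasurableSpace (A j)]
    (m m' : ∀ j, Measure (A j)) [∀ j, IsProbabilityMeasure (m j)]
    [∀ j, IsProbabilityMeasure (m' j)] (i : Fin n) (h : ∀ j, j ≠ i → m' j = m j) :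
    Measure.pi m' =
      ((m' i).prod (Measure.pi m)).map fun p => Function.update p.2 i p.1 := by
  refine Measure.pi_eq fun s hs => ?_
  have hu : Measurable fun p : A i × (∀ j, A j) => Function.update p.2 i p.1 :=
    measurable_update'.comp measurable_swap
  rw [Measure.map_apply hu (.univ_pi hs)]
  -- The `i`-th coordinate drawn from `m` is overwritten, hence unconstrained, and contributes the
  -- factor `1`.
  have : (fun p : A i × (∀ j, A j) => Function.update p.2 i p.1) ⁻¹' Set.univ.pi s =
      s i ×ˢ Set.univ.pi (Function.update s i Set.univ) := by
    ext ⟨x, a⟩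
    simp only [Set.mem_preimage, Set.mem_univ_pi, Set.mem_prod]
    refine ⟨fun hx => ⟨by simpa using hx i, fun j => ?_⟩, fun hx j => ?_⟩
    · obtain rfl | hj := eq_or_ne j i
      · simp
      · simpa [hj] using hx j
    · obtain rfl | hj := eq_or_ne j i
      · simpa using hx.1
      · simpa [hj] using hx.2 j
  rw [this, Measure.prod_prod, Measure.pi_pi, ← Finset.mul_prod_erase _ _ (Finset.mem_univ i),
    ← Finset.mul_prod_erase _ _ (Finset.mem_univ i)]
  simp only [Function.update_self, measure_univ, one_mul]
  congr 1
  refine Finset.prod_congr rfl fun j hj => ?_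
  rw [Function.update_of_ne (Finset.ne_of_mem_erase hj), h j (Finset.ne_of_mem_erase hj)]

section JoinTypes

variable {n : ℕ} {T : Fin n → Type*} (i : Fin n)

@[simp]
theorem joinTypes_self (ti : T i) (tmi : OtherTypes T i) : joinTypes i ti tmi i = ti := by
  simp [joinTypes, Equiv.piSplitAt]

theorem joinTypes_of_ne (ti : T i) (tmi : OtherTypes T i) {j : Fin n} (hj : j ≠ i) :
    joinTypes i ti tmi j = tmi ⟨j, hj⟩ := by
  simp [joinTypes, Equiv.piSplitAt, hj]

theorem joinTypes_others (ti : T i) (tmi : OtherTypes T i) :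
    (fun j : {j : Fin n // j ≠ i} => joinTypes i ti tmi j) = tmi :=
  funext fun j => joinTypes_of_ne i ti tmi j.2

variable [∀ j, MeasurableSpace (T j)]

theorem measurable_joinTypes :
    Measurable fun p : T i × OtherTypes T i => joinTypes i p.1 p.2 := by
  refine measurable_pi_iff.2 fun j => ?_
  obtain rfl | hj := eq_or_ne j i
  · simpa using measurable_fst
  · simp only [joinTypes_of_ne i _ _ hj]
    fun_prop

theorem measurePreserving_pi_joinTypes (m : ∀ j, Measure (T j)) [∀ j, IsProbabilityMeasure (m j)] :
    MeasurePreserving (fun p : T i × OtherTypes T i => joinTypes i p.1 p.2)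
      ((m i).prod (Measure.pi fun j : {j : Fin n // j ≠ i} => m j)) (Measure.pi m) := by
  refine ⟨measurable_joinTypes i, (Measure.pi_eq fun s hs => ?_).symm⟩
  rw [Measure.map_apply (measurable_joinTypes i) (.univ_pi hs)]
  have : (fun p : T i × OtherTypes T i => joinTypes i p.1 p.2) ⁻¹' Set.univ.pi s =
      s i ×ˢ Set.univ.pi fun j : {j : Fin n // j ≠ i} => s j := by
    ext ⟨x, a⟩
    simp only [Set.mem_preimage, Set.mem_univ_pi, Set.mem_prod]
    refine ⟨fun hx => ⟨by simpa using hx i, fun j => ?_⟩, fun hx j => ?_⟩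
    · simpa [joinTypes_of_ne i x a j.2] using hx j
    · obtain rfl | hj := eq_or_ne j i
      · simpa using hx.1
      · simpa [joinTypes_of_ne i x a hj] using hx.2 ⟨j, hj⟩
  rw [this, Measure.prod_prod, Measure.pi_pi, ← Finset.mul_prod_erase _ _ (Finset.mem_univ i)]
  congr 1
  exact (Finset.prod_subtype _ (fun j => by simp) fun j => m j (s j)).symm

instance ProductProb.isProbabilityMeasure_others {S : Type*} [MeasurableSpace S]
    (ν : ProductProb S T) : IsProbabilityMeasure (ν.others i) := by
  have := ν.prob_nature
  have := ν.prob_type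
  unfold ProductProb.others
  infer_instance

/-- Carries ex ante integrals to the space `T_i × (S × T_{-i})` on which the belief density lives.
-/
theorem ProductProb.measurePreserving_joinTypes {S : Type*} [MeasurableSpace S]
    (ν : ProductProb S T) :
    MeasurePreserving (fun x : T i × S × OtherTypes T i => (x.2.1, joinTypes i x.1 x.2.2))
      ((ν.type i).prod (ν.others i)) ν.measure := by
  have := ν.prob_nature
  have := ν.prob_type
  have h₁ := Measure.measurePreserving_swap (μ := ν.type i) (ν := ν.others i)
  have h₂ : MeasurePreserving MeasurableEquiv.prodAssoc ((ν.others i).prod (ν.type i)) _ :=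
    ⟨MeasurableEquiv.prodAssoc.measurable, Measure.prodAssoc_prod⟩
  have h₃ := (MeasurePreserving.id ν.nature).prod
    ((measurePreserving_pi_joinTypes i ν.type).comp Measure.measurePreserving_swap)
  exact (h₃.comp h₂).comp h₁

end JoinTypes

/-! ### Payoffs under behavioral strategies. -/

section MixedPayoff

variable {n : ℕ} {S : Type*} {T A : Fin n → Type*} [∀ i, MeasurableSpace (T i)]
  [∀ i, MeasurableSpace (A i)]

/-- The kernel from type profiles to action profiles induced by a profile of behavioral
strategies. -/
noncomputable def StrategyProfile.kernel (γ : StrategyProfile T A) :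
    Kernel (∀ j, T j) (∀ j, A j) where
  toFun t := haveI := fun j => (γ j).2
    Measure.pi fun j => (γ j).1 (t j)
  measurable' := by
    have := fun j => (γ j).2
    refine Measurable.measure_of_isPiSystem_of_isProbabilityMeasure generateFrom_pi.symm
      isPiSystem_pi ?_
    rintro _ ⟨s, hs, rfl⟩
    simp only [Measure.pi_pi]
    exact Finset.measurable_fun_prod _ fun j _ =>
      ((γ j).1.measurable_coe (hs j (Set.mem_univ j))).comp (measurable_pi_apply j)

instance (γ : StrategyProfile T A) : IsMarkovKernel γ.kernel :=
  ⟨fun t => by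
    have := fun j => (γ j).2
    change IsProbabilityMeasure (Measure.pi fun j => (γ j).1 (t j))
    infer_instance⟩

theorem mixedPayoff_eq (v : (∀ j, A j) → S → (∀ j, T j) → ℝ) (γ : StrategyProfile T A) (s : S)
    (t : ∀ j, T j) : mixedPayoff v γ s t = ∫ a, v a s t ∂(γ.kernel t) := rfl

/-- The parameter in `P` carries the action of a pure deviation; `P = Unit` gives the payoff without
deviation. -/
theorem measurable_mixedPayoff [MeasurableSpace S] {P : Type*} [MeasurableSpace P]
    {v : P → (∀ j, A j) → S → (∀ j, T j) → ℝ}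
    (hv : Measurable fun x : P × (∀ j, A j) × S × (∀ j, T j) => v x.1 x.2.1 x.2.2.1 x.2.2.2)
    (γ : StrategyProfile T A) :
    Measurable fun x : P × S × (∀ j, T j) => mixedPayoff (v x.1) γ x.2.1 x.2.2 := by
  have hm : Measurable fun x : P × S × (∀ j, T j) => x.2.2 := by fun_prop
  refine (StronglyMeasurable.integral_kernel_prod_right' (κ := γ.kernel.comap _ hm)
    (f := fun y : (P × S × (∀ j, T j)) × (∀ j, A j) => v y.1.1 y.2 y.1.2.1 y.1.2.2) ?_).measurable
  have hg : Measurable fun y : (P × S × (∀ j, T j)) × (∀ j, A j) =>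
    (y.1.1, y.2, y.1.2.1, y.1.2.2) := by fun_prop
  exact (hv.comp hg).stronglyMeasurable

theorem abs_mixedPayoff_le {v : (∀ j, A j) → S → (∀ j, T j) → ℝ} {s : S} {t : ∀ j, T j} {C : ℝ}
    (hv : ∀ a, |v a s t| ≤ C) (γ : StrategyProfile T A) : |mixedPayoff v γ s t| ≤ C := by
  rw [mixedPayoff_eq]
  simpa using norm_integral_le_of_norm_le_const (f := fun a => v a s t) (C := C)
    (ae_of_all (γ.kernel t) hv)

theorem mixedPayoff_congr {v : (∀ j, A j) → S → (∀ j, T j) → ℝ} {γ γ' : StrategyProfile T A}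
    {s : S} {t : ∀ j, T j} (h : ∀ j, (γ j).1 (t j) = (γ' j).1 (t j)) :
    mixedPayoff v γ s t = mixedPayoff v γ' s t := by
  simp only [mixedPayoff, h]

/-- The mixed payoff after a deviation is the average of the payoffs of pure deviations. -/
theorem mixedPayoff_update {v : (∀ j, A j) → S → (∀ j, T j) → ℝ} {s : S} {t : ∀ j, T j} {C : ℝ}
    (hm : Measurable fun a => v a s t) (hv : ∀ a, |v a s t| ≤ C) (γ : StrategyProfile T A)
    (i : Fin n) (δ : BehavioralStrategy (T i) (A i)) :
    mixedPayoff v (Function.update γ i δ) s t =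
      ∫ x, mixedPayoff (fun a => v (Function.update a i x)) γ s t ∂(δ.1 (t i)) := by
  have := fun j => (γ j).2
  have := fun j => (Function.update γ i δ j).2
  have := δ.2
  have hu : Measurable fun p : A i × (∀ j, A j) => Function.update p.2 i p.1 :=
    measurable_update'.comp measurable_swap
  rw [mixedPayoff, pi_eq_map_update (fun j => (γ j).1 (t j)) _ i
    (fun j hj => by rw [Function.update_of_ne hj]),
    integral_map hu.aemeasurable hm.aestronglyMeasurable, integral_prod]
  · simp only [Function.update_self]
    rfl
  · exact Integrable.of_bound (hm.comp hu).aestronglyMeasurable C (ae_of_all _ fun p => hv _)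

end MixedPayoff

/-! ### Interim and ex ante payoffs. -/

namespace IncompleteInfoGame

variable {n : ℕ} {S : Type*} {T A : Fin n → Type*} [MeasurableSpace S]
  [∀ i, MeasurableSpace (T i)] [∀ i, MeasurableSpace (A i)] {G : IncompleteInfoGame S T A}
  {ubar : ∀ i, T i → ℝ≥0}

instance isMarkovKernel_η (G : IncompleteInfoGame S T A) (i : Fin n) : IsMarkovKernel (G.η i) :=
  G.markov_η i

/-- The interim payoff of player `i` as a function of type and own pure action. -/
noncomputable def pureDeviationPayoff (G : IncompleteInfoGame S T A) (i : Fin n)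
    (γ : StrategyProfile T A) (ti : T i) (x : A i) : ℝ :=
  ∫ p, mixedPayoff (fun a => G.u i (Function.update a i x)) γ p.1 (joinTypes i ti p.2)
    ∂(G.η i ti)

theorem measurable_mixedPayoff_joinTypes (G : IncompleteInfoGame S T A) (i : Fin n)
    (γ : StrategyProfile T A) :
    Measurable fun x : T i × S × OtherTypes T i =>
      mixedPayoff (G.u i) γ x.2.1 (joinTypes i x.1 x.2.2) := by
  have hm := measurable_mixedPayoff (P := Unit) (v := fun _ => G.u i)
    ((G.measurable_u i).comp measurable_snd) γ
  have hj : Measurable fun x : T i × S × OtherTypes T i => joinTypes i x.1 x.2.2 :=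
    (measurable_joinTypes i).comp (measurable_fst.prodMk measurable_snd.snd)
  exact hm.comp (measurable_const.prodMk (measurable_snd.fst.prodMk hj) :
    Measurable fun x : T i × S × OtherTypes T i => ((), x.2.1, joinTypes i x.1 x.2.2))

theorem measurable_mixedPayoff_pureDeviation (G : IncompleteInfoGame S T A) (i : Fin n)
    (γ : StrategyProfile T A) :
    Measurable fun y : (A i × T i) × S × OtherTypes T i =>
      mixedPayoff (fun a => G.u i (Function.update a i y.1.1)) γ y.2.1
        (joinTypes i y.1.2 y.2.2) := by
  have hu : Measurable fun x : A i × (∀ j, A j) × S × (∀ j, T j) =>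
      Function.update x.2.1 i x.1 :=
    measurable_update'.comp (measurable_snd.fst.prodMk measurable_fst)
  have hm := measurable_mixedPayoff (P := A i) (v := fun x a => G.u i (Function.update a i x))
    ((G.measurable_u i).comp (hu.prodMk measurable_snd.snd)) γ
  have hj : Measurable fun y : (A i × T i) × S × OtherTypes T i => joinTypes i y.1.2 y.2.2 :=
    (measurable_joinTypes i).comp (measurable_fst.snd.prodMk measurable_snd.snd)
  exact hm.comp (measurable_fst.fst.prodMk (measurable_snd.fst.prodMk hj))

theorem measurable_expectedPayoff (G : IncompleteInfoGame S T A) (i : Fin n)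
    (γ : StrategyProfile T A) : Measurable (G.expectedPayoff i γ) :=
  (StronglyMeasurable.integral_kernel_prod_right' (κ := G.η i)
    (G.measurable_mixedPayoff_joinTypes i γ).stronglyMeasurable).measurable

theorem measurable_pureDeviationPayoff (G : IncompleteInfoGame S T A) (i : Fin n)
    (γ : StrategyProfile T A) :
    Measurable fun p : A i × T i => G.pureDeviationPayoff i γ p.2 p.1 :=
  (StronglyMeasurable.integral_kernel_prod_right'
    (κ := (G.η i).comap (Prod.snd : A i × T i → T i) measurable_snd)
    (G.measurable_mixedPayoff_pureDeviation i γ).stronglyMeasurable).measurable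

theorem PayoffBound.abs_mixedPayoff_le (h : G.PayoffBound ubar) (i : Fin n)
    (γ : StrategyProfile T A) (ti : T i) (p : S × OtherTypes T i) :
    |mixedPayoff (G.u i) γ p.1 (joinTypes i ti p.2)| ≤ ubar i ti :=
  _root_.abs_mixedPayoff_le (fun a => by simpa using (h i).2 a p.1 (joinTypes i ti p.2)) γ

theorem PayoffBound.abs_expectedPayoff_le (h : G.PayoffBound ubar) (i : Fin n)
    (γ : StrategyProfile T A) (ti : T i) : |G.expectedPayoff i γ ti| ≤ ubar i ti := by
  simpa [expectedPayoff] using norm_integral_le_of_norm_le_const (C := (ubar i ti : ℝ))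
    (f := fun p => mixedPayoff (G.u i) γ p.1 (joinTypes i ti p.2))
    (ae_of_all (G.η i ti) (h.abs_mixedPayoff_le i γ ti))

theorem PayoffBound.abs_pureDeviationPayoff_integrand_le (h : G.PayoffBound ubar) (i : Fin n)
    (γ : StrategyProfile T A) (ti : T i) (x : A i) (p : S × OtherTypes T i) :
    |mixedPayoff (fun a => G.u i (Function.update a i x)) γ p.1 (joinTypes i ti p.2)| ≤
      ubar i ti :=
  _root_.abs_mixedPayoff_le (fun a => by simpa using (h i).2 _ p.1 (joinTypes i ti p.2)) γ

theorem PayoffBound.abs_pureDeviationPayoff_le (h : G.PayoffBound ubar) (i : Fin n)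
    (γ : StrategyProfile T A) (ti : T i) (x : A i) :
    |G.pureDeviationPayoff i γ ti x| ≤ ubar i ti := by
  simpa [pureDeviationPayoff] using norm_integral_le_of_norm_le_const (C := (ubar i ti : ℝ))
    (f := fun p => mixedPayoff (fun a => G.u i (Function.update a i x)) γ p.1 (joinTypes i ti p.2))
    (ae_of_all (G.η i ti) (h.abs_pureDeviationPayoff_integrand_le i γ ti x))

/-- The interim payoff after a deviation is the average of the payoffs of pure deviations. -/
theorem PayoffBound.expectedPayoff_update (h : G.PayoffBound ubar) (i : Fin n)
    (γ : StrategyProfile T A) (δ : BehavioralStrategy (T i) (A i)) (ti : T i) :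
    G.expectedPayoff i (Function.update γ i δ) ti =
      ∫ x, G.pureDeviationPayoff i γ ti x ∂(δ.1 ti) := by
  have := δ.2
  have hm : ∀ p : S × OtherTypes T i, Measurable fun a => G.u i a p.1 (joinTypes i ti p.2) :=
    fun p => (G.measurable_u i).comp (measurable_id.prodMk measurable_const :
      Measurable fun a : ∀ j, A j => (a, p.1, joinTypes i ti p.2))
  have hu : ∀ p : S × OtherTypes T i,
      mixedPayoff (G.u i) (Function.update γ i δ) p.1 (joinTypes i ti p.2) =
        ∫ x, mixedPayoff (fun a => G.u i (Function.update a i x)) γ p.1 (joinTypes i ti p.2)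
          ∂(δ.1 ti) := fun p => by
    rw [mixedPayoff_update (hm p)
      (fun a => by simpa using (h i).2 a p.1 (joinTypes i ti p.2)) γ i δ, joinTypes_self]
  simp only [expectedPayoff, pureDeviationPayoff, hu]
  -- Fubini applies because, at a fixed type, the integrand is bounded by the constant `ubar i ti`.
  refine integral_integral_swap ?_
  refine Integrable.of_bound (Measurable.aestronglyMeasurable ?_) (ubar i ti)
    (ae_of_all _ fun y => h.abs_pureDeviationPayoff_integrand_le i γ ti y.2 y.1)
  have hg : Measurable fun y : (S × OtherTypes T i) × A i => ((y.2, ti), y.1) := by fun_prop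
  exact (G.measurable_mixedPayoff_pureDeviation i γ).comp hg

theorem PayoffBound.integrable_expectedPayoff (h : G.PayoffBound ubar) (i : Fin n)
    (γ : StrategyProfile T A) {μ : Measure (T i)} (hμ : ∫⁻ ti, (ubar i ti : ℝ≥0∞) ∂μ < ∞) :
    Integrable (G.expectedPayoff i γ) μ := by
  have hub : Integrable (fun ti => (ubar i ti : ℝ)) μ :=
    ⟨(h i).1.coe_nnreal_real.aestronglyMeasurable, by simpa [HasFiniteIntegral] using hμ⟩
  exact hub.mono' (G.measurable_expectedPayoff i γ).aestronglyMeasurable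
    (ae_of_all _ (h.abs_expectedPayoff_le i γ))

/-- The payoff of pure deviations is upper semicontinuous in the action. -/
theorem UpperSemicontinuousPayoffs.pureDeviationPayoff [∀ i, TopologicalSpace (A i)]
    [∀ i, FirstCountableTopology (A i)] (husc : G.UpperSemicontinuousPayoffs)
    (h : G.PayoffBound ubar) (i : Fin n) (γ : StrategyProfile T A) (ti : T i) :
    UpperSemicontinuous (G.pureDeviationPayoff i γ ti) := by
  refine upperSemicontinuous_integral_of_bounded (G.η i ti) (C := ubar i ti) (fun x => ?_)
    (h.abs_pureDeviationPayoff_integrand_le i γ ti) fun p => ?_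
  · exact (G.measurable_mixedPayoff_pureDeviation i γ).comp
      (measurable_const.prodMk measurable_id :
        Measurable fun p : S × OtherTypes T i => ((x, ti), p))
  · refine upperSemicontinuous_integral_of_bounded (γ.kernel (joinTypes i ti p.2))
      (C := ubar i ti) (h := fun x a => G.u i (Function.update a i x) p.1 (joinTypes i ti p.2))
      (fun x => ?_) (fun x a => ?_) fun a => husc i a p.1 (joinTypes i ti p.2)
    · exact (G.measurable_u i).comp (measurable_update_left.prodMk measurable_const :
        Measurable fun a : ∀ j, A j => (Function.update a i x, p.1, joinTypes i ti p.2))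
    · simpa using (h i).2 (Function.update a i x) p.1 (joinTypes i ti p.2)

/-- The ex ante payoff is the mean of the interim payoffs. -/
theorem PayoffBound.exAntePayoff_eq (h : G.PayoffBound ubar) {ν : ProductProb S T}
    (hν : ν ∈ G.M ubar) {f : ∀ i, T i × S × OtherTypes T i → ℝ≥0} (hf : G.IsBeliefDensity ν f)
    (i : Fin n) (γ : StrategyProfile T A) :
    G.exAntePayoff ν f i γ = ∫ ti, G.expectedPayoff i γ ti ∂(ν.type i) := by
  have := ν.prob_type i
  let H : T i × S × OtherTypes T i → ℝ := fun x =>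
    mixedPayoff (G.u i) γ x.2.1 (joinTypes i x.1 x.2.2)
  have hH : Measurable H := G.measurable_mixedPayoff_joinTypes i γ
  -- The density does not depend on actions, so it leaves the integral over action profiles.
  have hw : ∀ s t, mixedPayoff (G.weightedPayoff f i) γ s t =
      mixedPayoff (G.u i) γ s t * f i (t i, s, fun j => t j) := fun s t => integral_mul_const _ _
  have hmeas : Measurable fun p : S × (∀ j, T j) =>
      mixedPayoff (G.weightedPayoff f i) γ p.1 p.2 := by
    simp only [hw]
    have hm := measurable_mixedPayoff (P := Unit) (v := fun _ => G.u i)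
      ((G.measurable_u i).comp measurable_snd) γ
    have hu : Measurable fun p : S × (∀ j, T j) => mixedPayoff (G.u i) γ p.1 p.2 :=
      hm.comp (measurable_const.prodMk measurable_id :
        Measurable fun p : S × (∀ j, T j) => ((), p))
    have hg : Measurable fun p : S × (∀ j, T j) =>
      (p.2 i, p.1, fun j : {j : Fin n // j ≠ i} => p.2 j) := by fun_prop
    exact hu.mul ((hf i).1.comp hg).coe_nnreal_real
  have hint : Integrable H ((ν.type i).compProd (G.η i)) := by
    rw [Measure.integrable_compProd_iff hH.aestronglyMeasurable]
    have hb : ∀ x, ‖H x‖ ≤ ubar i x.1 := fun x => h.abs_mixedPayoff_le i γ x.1 x.2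
    have hub : Integrable (fun ti => (ubar i ti : ℝ)) (ν.type i) :=
      ⟨(h i).1.coe_nnreal_real.aestronglyMeasurable,
        by simpa [HasFiniteIntegral] using hν.2 i⟩
    refine ⟨ae_of_all _ fun ti => Integrable.of_bound
      (hH.comp measurable_prodMk_left).aestronglyMeasurable (ubar i ti) (ae_of_all _ fun p => hb (ti, p)),
      hub.mono' ?_ (ae_of_all _ fun ti => ?_)⟩
    · exact (StronglyMeasurable.integral_kernel_prod_right' (κ := G.η i)
        hH.norm.stronglyMeasurable).aestronglyMeasurable
    · simpa using norm_integral_le_of_norm_le_const (C := (ubar i ti : ℝ))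
        (f := fun p => ‖H (ti, p)‖) (ae_of_all (G.η i ti) fun p => by simpa using hb (ti, p))
  calc G.exAntePayoff ν f i γ
      = ∫ x, H x * f i x ∂((ν.type i).prod (ν.others i)) := by
        rw [exAntePayoff, ← (ν.measurePreserving_joinTypes i).map_eq,
          integral_map (ν.measurePreserving_joinTypes i).measurable.aemeasurable
            hmeas.aestronglyMeasurable]
        simp only [hw, joinTypes_self, joinTypes_others, H]
    _ = ∫ x, H x ∂((ν.type i).compProd (G.η i)) := by
        rw [(hf i).2, integral_withDensity_eq_integral_smul (hf i).1]
        simp only [NNReal.smul_def, smul_eq_mul, mul_comm]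
    _ = _ := Measure.integral_compProd hint

/-! ### Null-set modifications and the two inclusions. -/

/-- Changing the strategies of the other players on null sets does not affect interim payoffs. -/
theorem expectedPayoff_congr {ν : ProductProb S T} {i : Fin n} {ti : T i}
    (hη : G.η i ti ≪ ν.others i) {γ γ' : StrategyProfile T A}
    (hi : (γ i).1 ti = (γ' i).1 ti)
    (h : ∀ j, j ≠ i → ∀ᵐ tj ∂(ν.type j), (γ j).1 tj = (γ' j).1 tj) :
    G.expectedPayoff i γ ti = G.expectedPayoff i γ' ti := by
  have := ν.prob_nature
  have := ν.prob_type
  have hae : ∀ᵐ p ∂(ν.others i), ∀ j : {j : Fin n // j ≠ i},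
      (γ j).1 (p.2 j) = (γ' j).1 (p.2 j) := by
    refine ae_all_iff.2 fun j => ?_
    exact ((Measure.quasiMeasurePreserving_eval
      (fun j : {j : Fin n // j ≠ i} => ν.type j) j).comp
        Measure.quasiMeasurePreserving_snd).ae (h j j.2)
  refine integral_congr_ae ((Filter.Eventually.mono (hη.ae_le hae)) fun p hp =>
    mixedPayoff_congr fun j => ?_)
  obtain rfl | hj := eq_or_ne j i
  · simpa using hi
  · simpa [joinTypes_of_ne i ti p.2 hj] using hp ⟨j, hj⟩

/-- After the deviation both profiles use `δ` for player `i`, so only opponents differ, and no type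
`ti` has to be excepted. -/
theorem expectedPayoff_update_congr {ν : ProductProb S T} {i : Fin n} {ti : T i}
    (hη : G.η i ti ≪ ν.others i) {γ γ' : StrategyProfile T A} (h : StrategyEquiv ν γ γ')
    (δ : BehavioralStrategy (T i) (A i)) :
    G.expectedPayoff i (Function.update γ i δ) ti =
      G.expectedPayoff i (Function.update γ' i δ) ti :=
  expectedPayoff_congr hη (by simp) fun j hj => by simpa [hj] using h j

/-- At `ν_i`-almost every type the two profiles have equal interim payoffs, with and without the
deviation, so interim optimality integrates. -/
theorem BEClosure_subset_BNE (hubar : G.PayoffBound ubar) {ν : ProductProb S T}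
    (hν : ν ∈ G.M ubar) {f : ∀ i, T i × S × OtherTypes T i → ℝ≥0}
    (hf : G.IsBeliefDensity ν f) : G.BEClosure ν ⊆ G.BNE ν f := by
  rintro γ ⟨γ', hγ', hequiv⟩ i δ
  rw [hubar.exAntePayoff_eq hν hf, hubar.exAntePayoff_eq hν hf]
  refine integral_mono_ae (hubar.integrable_expectedPayoff i _ (hν.2 i))
    (hubar.integrable_expectedPayoff i _ (hν.2 i)) ?_
  filter_upwards [hequiv i] with ti hti
  rw [expectedPayoff_update_congr (hν.1 i ti) hequiv,
    expectedPayoff_congr (hν.1 i ti) hti fun j _ => hequiv j]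
  exact hγ' i ti δ

/-- An everywhere optimal pure reply `σ i` dominates `γ i` pointwise, while ex ante optimality
forces equal means. Hence `γ i` is suboptimal only on a null set, where it can be repaired. -/
theorem BNE_subset_BEClosure [∀ i, TopologicalSpace (A i)] [∀ i, CompactSpace (A i)]
    [∀ i, TopologicalSpace.MetrizableSpace (A i)] [∀ i, BorelSpace (A i)]
    (hT : ∀ i, IsUniversallyComplete (T i)) (hubar : G.PayoffBound ubar)
    (husc : G.UpperSemicontinuousPayoffs) {ν : ProductProb S T} (hν : ν ∈ G.M ubar)
    {f : ∀ i, T i × S × OtherTypes T i → ℝ≥0} (hf : G.IsBeliefDensity ν f) :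
    G.BNE ν f ⊆ G.BEClosure ν := by
  classical
  intro γ hγ
  have := fun i => (γ i).2
  have := ν.prob_type
  -- Selecting a maximizer needs nonempty action spaces. A probability measure on `T i` yields a
  -- type, and the mixed action there yields an action.
  have hne : ∀ i, Nonempty (A i) := fun i => by
    obtain ⟨ti⟩ := (ν.type i).nonempty_of_neZero
    exact ((γ i).1 ti).nonempty_of_neZero
  choose σ hσ hmax using fun i => (hT i).exists_measurable_argmax
    (G.measurable_pureDeviationPayoff i γ) (husc.pureDeviationPayoff hubar i γ)
  let pure : ∀ i, BehavioralStrategy (T i) (A i) := fun i =>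
    ⟨Kernel.deterministic (σ i) (hσ i), inferInstance⟩
  have hbest : ∀ i ti (δ : BehavioralStrategy (T i) (A i)),
      G.expectedPayoff i (Function.update γ i δ) ti ≤
        G.expectedPayoff i (Function.update γ i (pure i)) ti := fun i ti δ => by
    have := δ.2
    have hm : Measurable (G.pureDeviationPayoff i γ ti) :=
      (G.measurable_pureDeviationPayoff i γ).comp measurable_prodMk_right
    rw [hubar.expectedPayoff_update, hubar.expectedPayoff_update]
    simp only [pure, Kernel.deterministic_apply]
    rw [integral_dirac' _ _ hm.stronglyMeasurable]
    simpa using integral_mono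
      (Integrable.of_bound hm.aestronglyMeasurable (ubar i ti)
        (ae_of_all (δ.1 ti) (hubar.abs_pureDeviationPayoff_le i γ ti)))
      (integrable_const _) (hmax i ti)
  -- The types at which `γ i` is already a best reply to `γ`. Measurability of `N i` makes the
  -- piecewise strategy a kernel.
  let N : ∀ i, Set (T i) := fun i =>
    {ti | G.expectedPayoff i γ ti = G.expectedPayoff i (Function.update γ i (pure i)) ti}
  have hN : ∀ i, MeasurableSet (N i) := fun i =>
    measurableSet_eq_fun (G.measurable_expectedPayoff i _) (G.measurable_expectedPayoff i _)
  have hNae : ∀ i, ∀ᵐ ti ∂(ν.type i), ti ∈ N i := fun i => by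
    have hi := hubar.integrable_expectedPayoff i γ (hν.2 i)
    have hi' := hubar.integrable_expectedPayoff i (Function.update γ i (pure i)) (hν.2 i)
    have hle : ∀ ti, G.expectedPayoff i γ ti ≤
        G.expectedPayoff i (Function.update γ i (pure i)) ti := fun ti => by
      simpa using hbest i ti (γ i)
    have hBNE := hγ i (pure i)
    rw [hubar.exAntePayoff_eq hν hf, hubar.exAntePayoff_eq hν hf] at hBNE
    exact (integral_eq_iff_of_ae_le hi hi' (ae_of_all _ hle)).1
      (le_antisymm (integral_mono hi hi' hle) hBNE)
  let γ' : StrategyProfile T A := fun i =>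
    ⟨Kernel.piecewise (hN i) (γ i).1 (pure i).1, inferInstance⟩
  have hequiv : StrategyEquiv ν γ γ' := fun i => by
    filter_upwards [hNae i] with ti hti
    simp [γ', Kernel.piecewise_apply, hti]
  refine ⟨γ', fun i ti δ => ?_, hequiv⟩
  -- All players are modified at once, but only on null sets, so best replies to `γ` remain best
  -- replies to `γ'` at every type.
  rw [← expectedPayoff_update_congr (hν.1 i ti) hequiv]
  refine (hbest i ti δ).trans_eq ?_
  -- On `N i` the strategy `γ i` is kept and attains the maximum by definition of `N i`; off it,
  -- `γ'` plays the maximizer `σ i`.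
  by_cases hti : ti ∈ N i
  · refine Eq.trans (Eq.symm hti) (expectedPayoff_congr (hν.1 i ti) ?_ fun j _ => hequiv j)
    simp [γ', Kernel.piecewise_apply, hti]
  · refine expectedPayoff_congr (hν.1 i ti) ?_ fun j hj => by simpa [hj] using hequiv j
    simp [γ', Kernel.piecewise_apply, hti]

end IncompleteInfoGame

theorem mainTheorem7 {n : ℕ} {S : Type*} {T A : Fin n → Type*}
    [MeasurableSpace S] [∀ i, MeasurableSpace (T i)]
    [∀ i, TopologicalSpace (A i)] [∀ i, CompactSpace (A i)]
    [∀ i, TopologicalSpace.MetrizableSpace (A i)]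
    [∀ i, MeasurableSpace (A i)] [∀ i, BorelSpace (A i)]
    (hT : ∀ i, IsUniversallyComplete (T i))
    (G : IncompleteInfoGame S T A)
    (ubar : ∀ i, T i → ℝ≥0) (hubar : G.PayoffBound ubar)
    (husc : G.UpperSemicontinuousPayoffs)
    (ν : ProductProb S T) (hν : ν ∈ G.M ubar)
    (f : ∀ i, T i × S × OtherTypes T i → ℝ≥0) (hf : G.IsBeliefDensity ν f) :
    G.BNE ν f = G.BEClosure ν :=
  (IncompleteInfoGame.BNE_subset_BEClosure hT hubar husc hν hf).antisymm
    (IncompleteInfoGame.BEClosure_subset_BNE hubar hν hf)
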